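/- Let $\mathcal D=\{[k2^{-n},(k+1)2^{-n}) : n\ge 0,\ 0\le k<2^n\}$ be the dyadic intervals of the unit interval and $\mathcal R=\mathcal D\times\mathcal D$ the dyadic rectangles of $[0,1]^2$. Identify a formal Haar series $f=\sum_{I\times J\in\mathcal R} f_{IJ}h_{I\times J}$ (with $h_{I\times J}=h_I\otimes h_J$, $h_I$ the $L^\infty$-normalised Haar functions) with its real coefficient array $(f_{IJ})_{I\times J\in\mathcal R}$. For $0<p\le 2$ put $$S(f)=\Big(\sum_{I\times J\in\mathcal R} f_{IJ}^2\,1_{I\times J}\Big)^{1/2},\qquad \|f\|_{H^p(\delta^2)}=\Big(\int_{[0,1]^2}S(f)^p\,dm\Big)^{1/p}\in[0,\infty],$$ where $m$ is Lebesgue measure, and $H^p(\delta^2)=\{f:\|f\|_{H^p(\delta^2)}<\infty\}$. For $0<\theta<1$ and $0<q\le 2$ put $$N_{\theta,q}(f)=\sup\Big\{\Big\|\sum_{I\times J\in\mathcal R}|f_{IJ}|^{1-\theta}|g_{IJ}|^{\theta}h_{I\times J}\Big\|_{H^q(\delta^2)} : \|g\|_{H^2(\delta^2)}\le 1\Big\}\in[0,\infty].$$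 **Theorem 4.1.** (i) For every $0<p\le 2$ there is a constant $c_p>0$, depending only on $p$, such that for all $0<\theta<1$, for $q$ given by $\frac1q=\frac{1-\theta}{p}+\frac{\theta}{2}$, and for all $f\in H^p(\delta^2)$, $$c_p\,\|f\|_{H^p(\delta^2)}^{1-\theta}\le N_{\theta,q}(f)\le \|f\|_{H^p(\delta^2)}^{1-\theta}.$$ (ii) Let $1<p<2$ and $\theta=2-\frac2p$, and let $X_0$ be Pisier's extrapolation lattice associated to $H^p(\delta^2)$ and $H^2(\delta^2)$, that is, the space of all $x=\sum x_{IJ}h_{I\times J}$ with $\|x\|_{X_0}=N_{\theta,p}(x)^{1/(1-\theta)}<\infty$. Then $X_0=H^1(\delta^2)$ as sets, and there is a constant $c>0$, depending only on $p$, such that for all coefficient arrays $x$ (both norms being allowed to be infinite) $$c\,\|x\|_{H^1(\delta^2)}\le\|x\|_{X_0}\le\|x\|_{H^1(\delta^2)}.$$ -/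

import Mathlib

open MeasureTheory Set
open scoped ENNReal

noncomputable section

/-- A dyadic interval of the unit interval, encoded by its level `n` and its position
`k < 2 ^ n`; the corresponding point set is `DyadicInterval.toSet`. -/
abbrev DyadicInterval : Type := Σ n : ℕ, Fin (2 ^ n)

/-- The point set `[k / 2 ^ n, (k + 1) / 2 ^ n)` of a dyadic interval. -/
def DyadicInterval.toSet (I : DyadicInterval) : Set ℝ :=
  Ico ((I.2 : ℝ) / 2 ^ I.1) (((I.2 : ℝ) + 1) / 2 ^ I.1)

/-- A dyadic rectangle `I × J` of the unit square. -/
abbrev DyadicRectangle : Type := DyadicInterval × DyadicInterval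

/-- The point set of a dyadic rectangle. -/
def DyadicRectangle.toSet (R : DyadicRectangle) : Set (ℝ × ℝ) :=
  DyadicInterval.toSet R.1 ×ˢ DyadicInterval.toSet R.2

/-- The closed unit square. -/
def unitSquare : Set (ℝ × ℝ) := Icc 0 1 ×ˢ Icc 0 1

/-- The square function `S(f) = (∑ f_R² 1_R)^(1/2)` of a real array indexed by the dyadic
rectangles (the coefficients of a formal Haar series), with values in `[0, ∞]`. -/
def squareFunction (f : DyadicRectangle → ℝ) (z : ℝ × ℝ) : ℝ≥0∞ :=
  (∑' R : DyadicRectangle,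
    (DyadicRectangle.toSet R).indicator (fun _ => ENNReal.ofReal (f R ^ 2)) z) ^ (1 / 2 : ℝ)

/-- The (quasi-)norm `(∫_{[0,1]²} S(f)^p dm)^(1/p)`, with values in `[0, ∞]`. -/
def hardyNorm (p : ℝ) (f : DyadicRectangle → ℝ) : ℝ≥0∞ :=
  (∫⁻ z in unitSquare, squareFunction f z ^ p) ^ (1 / p)

/-- The bi-parameter dyadic Hardy space `H^p(δ²)`, as a space of coefficient arrays. -/
def hardySpace (p : ℝ) : Set (DyadicRectangle → ℝ) :=
  {f | hardyNorm p f < ∞}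

/-- The coefficient array `|f_R|^(1-θ) |g_R|^θ`. -/
def calderonProduct (θ : ℝ) (f g : DyadicRectangle → ℝ) : DyadicRectangle → ℝ :=
  fun R => |f R| ^ (1 - θ) * |g R| ^ θ

/-- The supremum of the `H^q(δ²)` norms of `∑ |f_R|^(1-θ) |g_R|^θ h_R` over all `g` in the
unit ball of `H²(δ²)`. -/
def extrapolationSup (θ q : ℝ) (f : DyadicRectangle → ℝ) : ℝ≥0∞ :=
  ⨆ (g : DyadicRectangle → ℝ) (_ : hardyNorm 2 g ≤ 1), hardyNorm q (calderonProduct θ f g)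

/-- The norm of Pisier's extrapolation lattice of `H^p(δ²)` and `H²(δ²)`, `1 < p < 2`, with
`θ = 2 - 2 / p`. The supremum is homogeneous of degree `1 - θ` in `x`, whence the power
`1 / (1 - θ)`. -/
def pisierNorm (p : ℝ) (x : DyadicRectangle → ℝ) : ℝ≥0∞ :=
  extrapolationSup (2 - 2 / p) p x ^ (1 / (1 - (2 - 2 / p)))

/-- Pisier's extrapolation lattice `X₀` of `H^p(δ²)` and `H²(δ²)`. -/
def pisierLattice (p : ℝ) : Set (DyadicRectangle → ℝ) :=
  {x | pisierNorm p x < ∞}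

end

/-! Write E = S(f)² (`energy`). The upper estimate is Hölder's inequality twice: over the rectangles
containing a point, giving E(product) ≤ E(f)^(1-θ) E(g)^θ, and then over the square.

The lower estimate tests the supremum on one explicit g. With K = ∫ E^(p/2) and b = 1 - p/2, let
g_R² be f_R² times the average of E^(-b) over R, divided by K (`extremalArray`). Since g_R²|R| =
f_R² ∫_R E^(-b) / K, summing over R gives ∫ E(g) ≤ ∫ E^(1-b) / K = 1. Jensen's inequality bounds the
average of E^(-b) below by a negative power of the average of E^a, hence by M^(-b/a) on R, where M
is the strong maximal function of E^a. This bound depends on the point and no longer on R, so it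
factors out of the sum: E(product) ≥ E (M^(-b/a)/K)^θ. For a = p/4, Doob's L² inequality in each
variable gives ∫ M² ≤ 16 K, and Hölder removes M, at the cost of a power of 16 bounded in terms of p
alone.

The second assertion is the first with endpoint exponent 1 and target exponent p. Arrays of infinite
H¹ norm are reached by finite truncations and monotone convergence. -/

section Maximal

/-! ### Doob's L² maximal inequality for nested countable partitions. -/

variable {α ι : Type*} [MeasurableSpace α]

/-- The normalised integral of `f` over the fibre of `π n` through `x`. -/
noncomputable def fiberAverage (μ : Measure α) (π : ℕ → α → ι) (c : ℕ → ℝ≥0∞) (f : α → ℝ≥0∞)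
    (n : ℕ) (x : α) : ℝ≥0∞ :=
  c n * ∫⁻ t in π n ⁻¹' {π n x}, f t ∂μ

/-- The maximal function associated with a sequence of countable partitions. -/
noncomputable def fiberMaximal (μ : Measure α) (π : ℕ → α → ι) (c : ℕ → ℝ≥0∞) (f : α → ℝ≥0∞)
    (x : α) : ℝ≥0∞ :=
  ⨆ n, fiberAverage μ π c f n x

variable {μ : Measure α} {π : ℕ → α → ι} {c : ℕ → ℝ≥0∞}

theorem fiberAverage_congr {f : α → ℝ≥0∞} {n : ℕ} {x y : α} (h : π n x = π n y) :
    fiberAverage μ π c f n x = fiberAverage μ π c f n y := by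
  simp [fiberAverage, h]

theorem fiberAverage_le (f : α → ℝ≥0∞) (n : ℕ) (x : α) :
    fiberAverage μ π c f n x ≤ c n * ∫⁻ t, f t ∂μ := by
  unfold fiberAverage
  gcongr
  exact Measure.restrict_le_self

theorem exists_partialSups_le (hcfin : ∀ n, c n ≠ ∞) {f : α → ℝ≥0∞}
    (hf : ∫⁻ t, f t ∂μ ≠ ∞) (n : ℕ) :
    ∃ B : ℝ≥0∞, B ≠ ∞ ∧ ∀ x, partialSups (fiberAverage μ π c f) n x ≤ B := by
  induction n with
  | zero =>
    exact ⟨_, ENNReal.mul_ne_top (hcfin 0) hf, fun x => by simpa using fiberAverage_le f 0 x⟩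
  | succ n ih =>
    obtain ⟨B, hB, h⟩ := ih
    refine ⟨B ⊔ (c (n + 1) * ∫⁻ t, f t ∂μ), ?_, fun x => ?_⟩
    · rw [← lt_top_iff_ne_top, sup_lt_iff]
      exact ⟨hB.lt_top, (ENNReal.mul_ne_top (hcfin _) hf).lt_top⟩
    · rw [partialSups_add_one]
      exact sup_le_sup (h x) (fiberAverage_le f _ x)

theorem partialSups_fiberAverage_congr
    (hπ' : ∀ n x y, π (n + 1) x = π (n + 1) y → π n x = π n y) (f : α → ℝ≥0∞) (n : ℕ) :
    ∀ x y, π n x = π n y →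
      partialSups (fiberAverage μ π c f) n x = partialSups (fiberAverage μ π c f) n y := by
  induction n with
  | zero => intro x y h; simpa using fiberAverage_congr h
  | succ n ih =>
    intro x y h
    rw [partialSups_add_one]
    simp only [Pi.sup_apply]
    rw [ih x y (hπ' n x y h), fiberAverage_congr h]

/-- The increment is nonzero only if b is the maximum, and then b² - a² = (b - a)(b + a) ≤ 2(b -
a)b. It controls one step of a running maximum. -/
theorem sq_max_le (a b : ℝ≥0∞) : (a ⊔ b) ^ 2 ≤ a ^ 2 + 2 * (((a ⊔ b) - a) * b) := by
  rcases le_total b a with h | h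
  · simp [sup_eq_left.2 h]
  · rw [sup_eq_right.2 h]
    obtain ⟨d, rfl⟩ := exists_add_of_le h
    by_cases ha : a = ∞
    · simp [ha]
    rw [ENNReal.add_sub_cancel_left ha]
    calc (a + d) ^ 2 ≤ (a + d) ^ 2 + d ^ 2 := le_self_add
      _ = a ^ 2 + 2 * (d * (a + d)) := by ring

theorem two_mul_mul_le_sq_add_sq (a b : ℝ≥0∞) : 2 * (2 * (a * b)) ≤ a ^ 2 + 4 * b ^ 2 := by
  by_cases ha : a = ∞
  · simp [ha]
  by_cases hb : b = ∞
  · simp [hb]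
  lift a to NNReal using ha
  lift b to NNReal using hb
  norm_cast
  rw [← NNReal.coe_le_coe]
  push_cast
  nlinarith [sq_nonneg ((a : ℝ) - 2 * b)]

variable [Countable ι] [MeasurableSpace ι] [MeasurableSingletonClass ι]

theorem lintegral_eq_tsum_fibers {g : α → ι} (hg : Measurable g) (u : α → ℝ≥0∞) :
    ∫⁻ x, u x ∂μ = ∑' k, ∫⁻ x in g ⁻¹' {k}, u x ∂μ := by
  rw [← lintegral_iUnion (fun k => hg (measurableSet_singleton k))]
  · rw [show ⋃ k, g ⁻¹' {k} = univ by ext x; simp, setLIntegral_univ]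
  · intro i j hij
    exact Disjoint.preimage _ (by simpa using hij)

theorem measurable_of_constant_on_fibers {g : α → ι} (hg : Measurable g) {d : α → ℝ≥0∞}
    (hd : ∀ x y, g x = g y → d x = d y) : Measurable d := by
  obtain ⟨φ, rfl⟩ : ∃ φ : ι → ℝ≥0∞, d = φ ∘ g :=
    ⟨Function.extend g d 0, by
      ext x
      exact (Function.FactorsThrough.extend_apply (fun a b h => hd a b h) 0 x).symm⟩
  exact (Measurable.of_discrete (f := φ)).comp hg

/-- A factor constant on the fibres passes through the conditional expectation; on each fibre the
loss is the factor `c n * μ (fibre) ≤ 1`. -/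
theorem lintegral_mul_fiberAverage_le (hπ : ∀ n, Measurable (π n))
    (hc : ∀ n k, c n * μ (π n ⁻¹' {k}) ≤ 1) (f : α → ℝ≥0∞) {d : α → ℝ≥0∞} {n : ℕ}
    (hd : ∀ x y, π n x = π n y → d x = d y) :
    ∫⁻ x, d x * fiberAverage μ π c f n x ∂μ ≤ ∫⁻ x, d x * f x ∂μ := by
  rw [lintegral_eq_tsum_fibers (hπ n), lintegral_eq_tsum_fibers (hπ n)]
  refine ENNReal.tsum_le_tsum fun k => ?_
  have hk : MeasurableSet (π n ⁻¹' {k}) := hπ n (measurableSet_singleton k)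
  rcases (π n ⁻¹' {k}).eq_empty_or_nonempty with he | ⟨x₀, hx₀⟩
  · simp [he]
  have h1 : ∫⁻ x in π n ⁻¹' {k}, d x * fiberAverage μ π c f n x ∂μ =
      ∫⁻ _ in π n ⁻¹' {k}, d x₀ * (c n * ∫⁻ t in π n ⁻¹' {k}, f t ∂μ) ∂μ := by
    refine setLIntegral_congr_fun hk fun x hx => ?_
    have hx' : π n x = k := hx
    have h0 : π n x₀ = k := hx₀
    simp only [fiberAverage, hx']
    rw [hd x x₀ (hx'.trans h0.symm)]
  have h2 : d x₀ * ∫⁻ t in π n ⁻¹' {k}, f t ∂μ ≤ ∫⁻ x in π n ⁻¹' {k}, d x * f x ∂μ := by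
    refine (lintegral_const_mul_le _ _).trans (le_of_eq ?_)
    refine setLIntegral_congr_fun hk fun x hx => ?_
    have hx' : π n x = k := hx
    have h0 : π n x₀ = k := hx₀
    rw [hd x x₀ (hx'.trans h0.symm)]
  rw [h1, setLIntegral_const]
  calc d x₀ * (c n * ∫⁻ t in π n ⁻¹' {k}, f t ∂μ) * μ (π n ⁻¹' {k})
      = (d x₀ * ∫⁻ t in π n ⁻¹' {k}, f t ∂μ) * (c n * μ (π n ⁻¹' {k})) := by ring
    _ ≤ (d x₀ * ∫⁻ t in π n ⁻¹' {k}, f t ∂μ) * 1 := by gcongr; exact hc n k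
    _ ≤ _ := by rw [mul_one]; exact h2

/-- Increments of the running maximum are constant on the current fibres, so the average in
`sq_max_le` may be replaced by `f`; the increments then telescope. -/
theorem lintegral_partialSups_sq_le (hπ : ∀ n, Measurable (π n))
    (hπ' : ∀ n x y, π (n + 1) x = π (n + 1) y → π n x = π n y)
    (hc : ∀ n k, c n * μ (π n ⁻¹' {k}) ≤ 1) {f : α → ℝ≥0∞} (hf : Measurable f) (n : ℕ) :
    ∫⁻ x, partialSups (fiberAverage μ π c f) n x ^ 2 ∂μ ≤
      2 * ∫⁻ x, partialSups (fiberAverage μ π c f) n x * f x ∂μ := by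
  induction n with
  | zero =>
    simp only [partialSups_zero, sq]
    refine (lintegral_mul_fiberAverage_le hπ hc f (fun x y h => fiberAverage_congr h)).trans ?_
    rw [two_mul]
    exact le_self_add
  | succ n ih =>
    set P := partialSups (fiberAverage μ π c f) with hP
    set A := fiberAverage μ π c f with hA
    have hPm : ∀ m, Measurable (P m) := fun m =>
      measurable_of_constant_on_fibers (hπ m) (partialSups_fiberAverage_congr hπ' f m)
    have hd : ∀ x y, π (n + 1) x = π (n + 1) y → P (n + 1) x - P n x = P (n + 1) y - P n y := by
      intro x y h
      rw [partialSups_fiberAverage_congr hπ' f (n + 1) x y h,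
        partialSups_fiberAverage_congr hπ' f n x y (hπ' n x y h)]
    have hdm : Measurable fun x => P (n + 1) x - P n x :=
      measurable_of_constant_on_fibers (hπ (n + 1)) hd
    calc ∫⁻ x, P (n + 1) x ^ 2 ∂μ
        ≤ ∫⁻ x, (P n x ^ 2 + 2 * ((P (n + 1) x - P n x) * A (n + 1) x)) ∂μ := by
          refine lintegral_mono fun x => ?_
          have h : P (n + 1) x = P n x ⊔ A (n + 1) x := by
            rw [hP, partialSups_add_one]; rfl
          rw [h]
          exact sq_max_le _ _
      _ = ∫⁻ x, P n x ^ 2 ∂μ + 2 * ∫⁻ x, (P (n + 1) x - P n x) * A (n + 1) x ∂μ := by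
          rw [lintegral_add_left ((hPm n).pow_const 2), lintegral_const_mul' _ _ (by simp)]
      _ ≤ 2 * ∫⁻ x, P n x * f x ∂μ + 2 * ∫⁻ x, (P (n + 1) x - P n x) * f x ∂μ := by
          gcongr 1
          gcongr 2 * ?_
          exact lintegral_mul_fiberAverage_le hπ hc f hd
      _ = 2 * ∫⁻ x, P (n + 1) x * f x ∂μ := by
          rw [← mul_add, ← lintegral_add_left (f := fun x => P n x * f x) ((hPm n).mul hf)]
          congr 1
          refine lintegral_congr fun x => ?_
          rw [← add_mul, add_tsub_cancel_of_le]
          exact (partialSups (fiberAverage μ π c f)).monotone (Nat.le_succ n) x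

/-- Doob's maximal inequality in `L²`. -/
theorem lintegral_fiberMaximal_sq_le [IsFiniteMeasure μ] (hπ : ∀ n, Measurable (π n))
    (hπ' : ∀ n x y, π (n + 1) x = π (n + 1) y → π n x = π n y)
    (hc : ∀ n k, c n * μ (π n ⁻¹' {k}) ≤ 1) (hcfin : ∀ n, c n ≠ ∞)
    {f : α → ℝ≥0∞} (hf : Measurable f) :
    ∫⁻ x, fiberMaximal μ π c f x ^ 2 ∂μ ≤ 4 * ∫⁻ x, f x ^ 2 ∂μ := by
  by_cases htop : ∫⁻ x, f x ^ 2 ∂μ = ∞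
  · simp [htop]
  have hf1 : ∫⁻ x, f x ∂μ ≠ ∞ := by
    refine ne_top_of_le_ne_top (b := ∫⁻ x, (1 + f x ^ 2) ∂μ) ?_ (lintegral_mono fun x => ?_)
    · rw [lintegral_add_left measurable_const]
      simp [htop]
    · rcases le_total (f x) 1 with h | h
      · exact h.trans le_self_add
      · calc f x = f x * 1 := (mul_one _).symm
          _ ≤ f x * f x := by gcongr
          _ ≤ _ := by rw [sq]; exact le_add_self
  set P := partialSups (fiberAverage μ π c f) with hP
  have hPm : ∀ m, Measurable (P m) := fun m =>
    measurable_of_constant_on_fibers (hπ m) (partialSups_fiberAverage_congr hπ' f m)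
  have hbound : ∀ n, ∫⁻ x, P n x ^ 2 ∂μ ≤ 4 * ∫⁻ x, f x ^ 2 ∂μ := by
    intro n
    obtain ⟨B, hB, hle⟩ := exists_partialSups_le (π := π) hcfin hf1 n
    -- Finiteness allows ∫ P² to be absorbed on the left after 4Pf ≤ P² + 4f².
    have hfin : ∫⁻ x, P n x ^ 2 ∂μ ≠ ∞ := by
      refine ne_top_of_le_ne_top (b := ∫⁻ _, B ^ 2 ∂μ) ?_ (lintegral_mono fun x => ?_)
      · rw [lintegral_const]
        exact ENNReal.mul_ne_top (ENNReal.pow_ne_top hB) (measure_ne_top _ _)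
      · have := hle x
        simp only
        gcongr
    have h1 := lintegral_partialSups_sq_le hπ hπ' hc hf n
    rw [← hP] at h1
    have h2 : 2 * (2 * ∫⁻ x, P n x * f x ∂μ) ≤
        ∫⁻ x, P n x ^ 2 ∂μ + 4 * ∫⁻ x, f x ^ 2 ∂μ := by
      rw [← lintegral_const_mul' _ _ (by simp), ← lintegral_const_mul' _ _ (by simp),
        ← lintegral_const_mul' _ _ (by simp), ← lintegral_add_left ((hPm n).pow_const 2)]
      exact lintegral_mono fun x => two_mul_mul_le_sq_add_sq _ _
    have h3 : ∫⁻ x, P n x ^ 2 ∂μ + ∫⁻ x, P n x ^ 2 ∂μ ≤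
        ∫⁻ x, P n x ^ 2 ∂μ + 4 * ∫⁻ x, f x ^ 2 ∂μ := by
      rw [← two_mul]
      exact (mul_le_mul_right h1 2).trans h2
    exact (ENNReal.add_le_add_iff_left hfin).1 h3
  have hsup : ∀ x, fiberMaximal μ π c f x ^ 2 = ⨆ n, P n x ^ 2 := by
    intro x
    have h1 : fiberMaximal μ π c f x = ⨆ n, P n x := by
      have := congrFun (iSup_partialSups_eq (fiberAverage μ π c f)) x
      rw [iSup_apply, iSup_apply] at this
      exact this.symm
    rw [h1]
    exact Monotone.map_iSup_of_continuousAt (f := fun a : ℝ≥0∞ => a ^ 2)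
      (ENNReal.continuous_pow 2).continuousAt (fun a b h => pow_le_pow_left' h 2) (by simp)
  simp_rw [hsup]
  rw [lintegral_iSup (fun n => (hPm n).pow_const 2)]
  · exact iSup_le hbound
  · intro m n hmn x
    simp only
    gcongr
    exact P.monotone hmn x

/-- Joint measurability, needed to apply the maximal operator one variable at a time and to use
Tonelli. -/
theorem measurable_fiberMaximal_prod {β : Type*} [MeasurableSpace β] [SFinite μ]
    (hπ : ∀ n, Measurable (π n)) {F : β × α → ℝ≥0∞} (hF : Measurable F) :
    Measurable fun z : β × α => fiberMaximal μ π c (fun t => F (z.1, t)) z.2 := by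
  unfold fiberMaximal fiberAverage
  refine Measurable.iSup fun n => Measurable.const_mul ?_ _
  have hS : MeasurableSet {w : (β × α) × α | π n w.2 = π n w.1.2} :=
    measurableSet_eq_fun ((hπ n).comp measurable_snd)
      ((hπ n).comp (measurable_snd.comp measurable_fst))
  have hm : Measurable ({w : (β × α) × α | π n w.2 = π n w.1.2}.indicator
      fun w => F (w.1.1, w.2)) :=
    (hF.comp ((measurable_fst.comp measurable_fst).prodMk measurable_snd)).indicator hS
  convert hm.lintegral_prod_right' (ν := μ) using 2 with z
  rw [← lintegral_indicator (hπ n (measurableSet_singleton _))]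
  rfl

end Maximal

/-! ### Dyadic intervals and rectangles, and the strong maximal function. -/

section Dyadic

/-- Lebesgue measure on the unit interval. -/
noncomputable def unitMeasure : Measure ℝ := volume.restrict (Icc 0 1)

instance : IsFiniteMeasure unitMeasure := by
  unfold unitMeasure; infer_instance

theorem volume_restrict_unitSquare :
    (volume : Measure (ℝ × ℝ)).restrict unitSquare = unitMeasure.prod unitMeasure := by
  rw [unitMeasure, Measure.prod_restrict, unitSquare, Measure.volume_eq_prod]

/-- The index, at level `n`, of the dyadic interval containing `x`. -/
noncomputable def dyadicIndex (n : ℕ) (x : ℝ) : ℤ := ⌊(2 : ℝ) ^ n * x⌋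

theorem measurable_dyadicIndex (n : ℕ) : Measurable (dyadicIndex n) :=
  Int.measurable_floor.comp (measurable_const.mul measurable_id)

theorem dyadicIndex_preimage (n : ℕ) (k : ℤ) :
    dyadicIndex n ⁻¹' {k} = Ico ((k : ℝ) / 2 ^ n) (((k : ℝ) + 1) / 2 ^ n) := by
  ext x
  have h : (0 : ℝ) < 2 ^ n := by positivity
  simp only [dyadicIndex, mem_preimage, mem_singleton_iff, Int.floor_eq_iff, mem_Ico,
    div_le_iff₀ h, lt_div_iff₀ h, mul_comm x]

theorem dyadicIndex_succ (n : ℕ) (x y : ℝ) (h : dyadicIndex (n + 1) x = dyadicIndex (n + 1) y) :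
    dyadicIndex n x = dyadicIndex n y := by
  have key : ∀ x, dyadicIndex n x = dyadicIndex (n + 1) x / 2 := by
    intro x
    have := Int.floor_div_natCast ((2 : ℝ) ^ (n + 1) * x) 2
    unfold dyadicIndex
    push_cast at this
    rw [← this]
    congr 1
    ring
  rw [key, key, h]

theorem volume_dyadicIndex_preimage (n : ℕ) (k : ℤ) :
    2 ^ n * (volume : Measure ℝ) (dyadicIndex n ⁻¹' {k}) = 1 := by
  rw [dyadicIndex_preimage, Real.volume_Ico, ← sub_div, add_sub_cancel_left,
    ENNReal.ofReal_div_of_pos (by positivity), ENNReal.ofReal_pow (by norm_num)]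
  simp only [ENNReal.ofReal_one, ENNReal.ofReal_ofNat]
  exact ENNReal.mul_div_cancel (by simp) (by simp)

/-- Only an inequality: the index runs over all integers, and cells outside the unit interval are
null. -/
theorem unitMeasure_dyadicIndex_preimage_le (n : ℕ) (k : ℤ) :
    2 ^ n * unitMeasure (dyadicIndex n ⁻¹' {k}) ≤ 1 := by
  rw [← volume_dyadicIndex_preimage n k]
  gcongr
  exact Measure.restrict_le_self

theorem DyadicInterval.toSet_eq_preimage (I : DyadicInterval) :
    I.toSet = dyadicIndex I.1 ⁻¹' {((I.2 : ℕ) : ℤ)} := by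
  rw [dyadicIndex_preimage]
  simp [DyadicInterval.toSet]

theorem DyadicInterval.measurableSet_toSet (I : DyadicInterval) : MeasurableSet I.toSet :=
  measurableSet_Ico

theorem DyadicInterval.toSet_subset (I : DyadicInterval) : I.toSet ⊆ Icc 0 1 := by
  intro x hx
  have h : (0 : ℝ) < 2 ^ I.1 := by positivity
  have h2 : ((I.2 : ℕ) : ℝ) + 1 ≤ 2 ^ I.1 := by exact_mod_cast I.2.2
  refine ⟨le_trans (by positivity) hx.1, hx.2.le.trans ?_⟩
  rw [div_le_one h]
  exact h2

theorem DyadicInterval.unitMeasure_toSet (I : DyadicInterval) :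
    2 ^ I.1 * unitMeasure I.toSet = 1 := by
  rw [unitMeasure, Measure.restrict_apply I.measurableSet_toSet,
    inter_eq_left.2 I.toSet_subset, I.toSet_eq_preimage, volume_dyadicIndex_preimage]

/-- The one-parameter dyadic maximal function on the unit interval. -/
noncomputable def dyadicMaximal (f : ℝ → ℝ≥0∞) (x : ℝ) : ℝ≥0∞ :=
  fiberMaximal unitMeasure dyadicIndex (fun n => 2 ^ n) f x

theorem lintegral_dyadicMaximal_sq_le {f : ℝ → ℝ≥0∞} (hf : Measurable f) :
    ∫⁻ x, dyadicMaximal f x ^ 2 ∂unitMeasure ≤ 4 * ∫⁻ x, f x ^ 2 ∂unitMeasure :=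
  lintegral_fiberMaximal_sq_le measurable_dyadicIndex dyadicIndex_succ
    unitMeasure_dyadicIndex_preimage_le (fun _ => by simp) hf

theorem measurable_dyadicMaximal_prod {F : ℝ × ℝ → ℝ≥0∞} (hF : Measurable F) :
    Measurable fun z : ℝ × ℝ => dyadicMaximal (fun t => F (z.1, t)) z.2 :=
  measurable_fiberMaximal_prod measurable_dyadicIndex hF

theorem DyadicInterval.average_le_dyadicMaximal (I : DyadicInterval) (f : ℝ → ℝ≥0∞) {x : ℝ}
    (hx : x ∈ I.toSet) : 2 ^ I.1 * ∫⁻ t in I.toSet, f t ∂unitMeasure ≤ dyadicMaximal f x := by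
  refine le_trans (le_of_eq ?_) (le_iSup _ I.1)
  rw [I.toSet_eq_preimage] at hx ⊢
  have : dyadicIndex I.1 x = ((I.2 : ℕ) : ℤ) := hx
  rw [fiberAverage, this]

/-- The iterated dyadic maximal function on the unit square; it dominates the averages over all
dyadic rectangles. -/
noncomputable def strongMaximal (F : ℝ × ℝ → ℝ≥0∞) (z : ℝ × ℝ) : ℝ≥0∞ :=
  dyadicMaximal (fun s => dyadicMaximal (fun t => F (s, t)) z.2) z.1

theorem measurable_strongMaximal {F : ℝ × ℝ → ℝ≥0∞} (hF : Measurable F) :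
    Measurable (strongMaximal F) := by
  set H : ℝ × ℝ → ℝ≥0∞ := fun z => dyadicMaximal (fun t => F (z.1, t)) z.2 with hH
  have h1 : Measurable (H ∘ Prod.swap) := (measurable_dyadicMaximal_prod hF).comp measurable_swap
  have h2 := measurable_dyadicMaximal_prod h1
  have h3 : strongMaximal F =
      (fun z : ℝ × ℝ => dyadicMaximal (fun t => (H ∘ Prod.swap) (z.1, t)) z.2) ∘ Prod.swap := rfl
  rw [h3]
  exact h2.comp measurable_swap

theorem lintegral_strongMaximal_sq_le {F : ℝ × ℝ → ℝ≥0∞} (hF : Measurable F) :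
    ∫⁻ z, strongMaximal F z ^ 2 ∂(unitMeasure.prod unitMeasure) ≤
      16 * ∫⁻ z, F z ^ 2 ∂(unitMeasure.prod unitMeasure) := by
  have hH := measurable_dyadicMaximal_prod hF
  calc ∫⁻ z, strongMaximal F z ^ 2 ∂(unitMeasure.prod unitMeasure)
      = ∫⁻ y, ∫⁻ x, strongMaximal F (x, y) ^ 2 ∂unitMeasure ∂unitMeasure :=
        lintegral_prod_symm _ ((measurable_strongMaximal hF).pow_const 2).aemeasurable
    _ ≤ ∫⁻ y, 4 * ∫⁻ x, dyadicMaximal (fun t => F (x, t)) y ^ 2 ∂unitMeasure ∂unitMeasure :=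
        lintegral_mono fun y => lintegral_dyadicMaximal_sq_le
          (f := fun s => dyadicMaximal (fun t => F (s, t)) y)
          (hH.comp (g := fun z : ℝ × ℝ => dyadicMaximal (fun t => F (z.1, t)) z.2)
            (f := fun s => (s, y)) (measurable_id.prodMk measurable_const))
    _ = 4 * ∫⁻ x, ∫⁻ y, dyadicMaximal (fun t => F (x, t)) y ^ 2 ∂unitMeasure ∂unitMeasure := by
        rw [lintegral_const_mul' _ _ (by simp)]
        congr 1
        exact (lintegral_prod_symm (fun z : ℝ × ℝ => dyadicMaximal (fun t => F (z.1, t)) z.2 ^ 2)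
          (hH.pow_const 2).aemeasurable).symm.trans
          (lintegral_prod _ (hH.pow_const 2).aemeasurable)
    _ ≤ 4 * ∫⁻ x, 4 * ∫⁻ y, F (x, y) ^ 2 ∂unitMeasure ∂unitMeasure := by
        gcongr with x
        exact lintegral_dyadicMaximal_sq_le (f := fun y => F (x, y)) (hF.comp (measurable_const.prodMk measurable_id))
    _ = 16 * ∫⁻ z, F z ^ 2 ∂(unitMeasure.prod unitMeasure) := by
        rw [lintegral_const_mul' _ _ (by simp), ← mul_assoc,
          lintegral_prod _ (hF.pow_const 2).aemeasurable]
        norm_num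

/-- The reciprocal of the area of a dyadic rectangle. -/
noncomputable def DyadicRectangle.invArea (R : DyadicRectangle) : ℝ≥0∞ := 2 ^ R.1.1 * 2 ^ R.2.1

theorem DyadicRectangle.measurableSet_toSet (R : DyadicRectangle) :
    MeasurableSet (DyadicRectangle.toSet R) :=
  R.1.measurableSet_toSet.prod R.2.measurableSet_toSet

theorem DyadicRectangle.invArea_ne_top (R : DyadicRectangle) :
    DyadicRectangle.invArea R ≠ ∞ := by
  simp [DyadicRectangle.invArea, ENNReal.mul_eq_top]

theorem DyadicRectangle.invArea_mul_measure (R : DyadicRectangle) :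
    DyadicRectangle.invArea R * (unitMeasure.prod unitMeasure) (DyadicRectangle.toSet R) = 1 := by
  rw [DyadicRectangle.invArea, DyadicRectangle.toSet, Measure.prod_prod, mul_mul_mul_comm,
    R.1.unitMeasure_toSet, R.2.unitMeasure_toSet, one_mul]

/-- By Tonelli the average over R is an iterated average, and each one-variable average is dominated
in turn. -/
theorem DyadicRectangle.average_le_strongMaximal (R : DyadicRectangle) {F : ℝ × ℝ → ℝ≥0∞}
    (hF : Measurable F) {z : ℝ × ℝ} (hz : z ∈ DyadicRectangle.toSet R) :
    DyadicRectangle.invArea R *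
      ∫⁻ w in DyadicRectangle.toSet R, F w ∂(unitMeasure.prod unitMeasure) ≤ strongMaximal F z := by
  rw [DyadicRectangle.toSet, ← Measure.prod_restrict, lintegral_prod _ hF.aemeasurable,
    DyadicRectangle.invArea, mul_assoc, ← lintegral_const_mul' _ _ (by simp)]
  refine le_trans ?_ (R.1.average_le_dyadicMaximal _ hz.1)
  gcongr with s
  exact R.2.average_le_dyadicMaximal _ hz.2

end Dyadic

/-! ### The square of the square function, and the upper estimate by Hölder. -/

section SquareFunction

/-- The square of the square function. -/
noncomputable def energy (f : DyadicRectangle → ℝ) (z : ℝ × ℝ) : ℝ≥0∞ :=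
  ∑' R : DyadicRectangle,
    (DyadicRectangle.toSet R).indicator (fun _ => ENNReal.ofReal (f R ^ 2)) z

theorem measurable_energy (f : DyadicRectangle → ℝ) : Measurable (energy f) :=
  Measurable.tsum fun R => measurable_const.indicator R.measurableSet_toSet

theorem hardyNorm_eq (p : ℝ) (f : DyadicRectangle → ℝ) :
    hardyNorm p f = (∫⁻ z, energy f z ^ (p / 2) ∂(unitMeasure.prod unitMeasure)) ^ (1 / p) := by
  rw [hardyNorm, volume_restrict_unitSquare]
  congr 1
  refine lintegral_congr fun z => ?_
  rw [squareFunction, ← ENNReal.rpow_mul]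
  congr 1
  ring

theorem tsum_rpow_mul_rpow_le {ι : Type*} (u v : ι → ℝ≥0∞) {s t : ℝ} (hs : 0 ≤ s) (ht : 0 ≤ t)
    (hst : s + t = 1) :
    ∑' i, u i ^ s * v i ^ t ≤ (∑' i, u i) ^ s * (∑' i, v i) ^ t := by
  let _ : MeasurableSpace ι := ⊤
  have hm : ∀ w : ι → ℝ≥0∞, Measurable w := fun w => measurable_from_top
  have h := ENNReal.lintegral_mul_norm_pow_le (μ := Measure.count)
    (hm u).aemeasurable (hm v).aemeasurable hs ht hst
  rwa [lintegral_count, lintegral_count, lintegral_count] at h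

theorem ofReal_calderonProduct_sq {θ : ℝ} (h0 : 0 < θ) (h1 : θ < 1) (f g : DyadicRectangle → ℝ)
    (R : DyadicRectangle) :
    ENNReal.ofReal (calderonProduct θ f g R ^ 2) =
      ENNReal.ofReal (f R ^ 2) ^ (1 - θ) * ENNReal.ofReal (g R ^ 2) ^ θ := by
  rw [ENNReal.ofReal_rpow_of_nonneg (sq_nonneg _) (sub_nonneg.2 h1.le),
    ENNReal.ofReal_rpow_of_nonneg (sq_nonneg _) h0.le, ← ENNReal.ofReal_mul (by positivity)]
  congr 1
  rw [calderonProduct, mul_pow, ← sq_abs (f R), ← sq_abs (g R), Real.rpow_pow_comm (abs_nonneg _),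
    Real.rpow_pow_comm (abs_nonneg _)]

theorem energy_calderonProduct_le {θ : ℝ} (h0 : 0 < θ) (h1 : θ < 1) (f g : DyadicRectangle → ℝ)
    (z : ℝ × ℝ) :
    energy (calderonProduct θ f g) z ≤ energy f z ^ (1 - θ) * energy g z ^ θ := by
  refine le_trans (le_of_eq ?_)
    (tsum_rpow_mul_rpow_le _ _ (sub_nonneg.2 h1.le) h0.le (sub_add_cancel 1 θ))
  refine tsum_congr fun R => ?_
  by_cases hz : z ∈ DyadicRectangle.toSet R
  · simp only [indicator_of_mem hz]
    exact ofReal_calderonProduct_sq h0 h1 f g R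
  · simp [indicator_of_notMem hz, sub_pos.2 h1]

theorem extrapolationSup_le {p θ q : ℝ} (hp : 0 < p) (h0 : 0 < θ) (h1 : θ < 1)
    (hq : 1 / q = (1 - θ) / p + θ / 2) (f : DyadicRectangle → ℝ) :
    extrapolationSup θ q f ≤ hardyNorm p f ^ (1 - θ) := by
  have h1' : 0 < 1 - θ := sub_pos.2 h1
  have hq0 : 0 < q := one_div_pos.1 (by rw [hq]; positivity)
  refine iSup₂_le fun g hg => ?_
  rw [hardyNorm_eq] at hg ⊢
  rw [hardyNorm_eq]
  set ν := unitMeasure.prod unitMeasure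
  -- The relation defining q, multiplied by q: these are the weights for Hölder on the square.
  have hsum : (1 - θ) * q / p + θ * q / 2 = 1 := by
    have : q * (1 / q) = 1 := by field_simp
    rw [hq] at this
    linear_combination this
  have hG : ∫⁻ z, energy g z ^ ((2 : ℝ) / 2) ∂ν ≤ 1 := by
    by_contra hlt
    exact absurd hg (not_le.2 (ENNReal.one_lt_rpow (not_le.1 hlt) (by norm_num)))
  have hmain : ∫⁻ z, energy (calderonProduct θ f g) z ^ (q / 2) ∂ν ≤
      (∫⁻ z, energy f z ^ (p / 2) ∂ν) ^ ((1 - θ) * q / p) := by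
    calc ∫⁻ z, energy (calderonProduct θ f g) z ^ (q / 2) ∂ν
        ≤ ∫⁻ z, (energy f z ^ (p / 2)) ^ ((1 - θ) * q / p) *
            (energy g z ^ ((2 : ℝ) / 2)) ^ (θ * q / 2) ∂ν := by
          refine lintegral_mono fun z => ?_
          refine (ENNReal.rpow_le_rpow (energy_calderonProduct_le h0 h1 f g z)
            (by positivity)).trans (le_of_eq ?_)
          rw [ENNReal.mul_rpow_of_nonneg _ _ (by positivity), ← ENNReal.rpow_mul,
            ← ENNReal.rpow_mul, ← ENNReal.rpow_mul, ← ENNReal.rpow_mul]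
          congr 2 <;> field_simp
      _ ≤ (∫⁻ z, energy f z ^ (p / 2) ∂ν) ^ ((1 - θ) * q / p) *
            (∫⁻ z, energy g z ^ ((2 : ℝ) / 2) ∂ν) ^ (θ * q / 2) :=
          ENNReal.lintegral_mul_norm_pow_le ((measurable_energy f).pow_const _).aemeasurable
            ((measurable_energy g).pow_const _).aemeasurable (by positivity) (by positivity) hsum
      _ ≤ (∫⁻ z, energy f z ^ (p / 2) ∂ν) ^ ((1 - θ) * q / p) * 1 := by
          gcongr
          exact ENNReal.rpow_le_one hG (by positivity)
      _ = _ := mul_one _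
  refine (ENNReal.rpow_le_rpow hmain (by positivity)).trans (le_of_eq ?_)
  rw [← ENNReal.rpow_mul, ← ENNReal.rpow_mul]
  congr 1
  field_simp

end SquareFunction

/-! ### The extremal array and the lower estimate. -/

section LowerBound

/-- Jensen's inequality comparing the averages of a negative and of a positive power. -/
theorem rpow_average_le_average_rpow {α : Type*} [MeasurableSpace α] {ν : Measure α} {c : ℝ≥0∞}
    {R : Set α} {E : α → ℝ≥0∞} (hE : Measurable E) {a b : ℝ} (ha : 0 < a) (hb : 0 ≤ b)
    (hfin : ∀ᵐ z ∂ν.restrict R, E z ≠ 0 ∧ E z ≠ ∞) (hc : 1 ≤ c * ν R) :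
    (c * ∫⁻ z in R, E z ^ a ∂ν) ^ (-(b / a)) ≤ c * ∫⁻ z in R, E z ^ (-b) ∂ν := by
  set m := c * ∫⁻ z in R, E z ^ a ∂ν with hm
  set w := c * ∫⁻ z in R, E z ^ (-b) ∂ν with hw
  have hab : 0 < a + b := by positivity
  have hs : 0 < a / (a + b) := by positivity
  have ht : 0 ≤ b / (a + b) := by positivity
  have hst : a / (a + b) + b / (a + b) = 1 := by field_simp
  -- Hölder applied to 1 = (E^(-b))^(a/(a+b)) (E^a)^(b/(a+b)), valid where E is neither 0 nor ∞.
  have hν : ν R ≤ (∫⁻ z in R, E z ^ (-b) ∂ν) ^ (a / (a + b)) *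
      (∫⁻ z in R, E z ^ a ∂ν) ^ (b / (a + b)) := by
    calc ν R = ∫⁻ z in R, (E z ^ (-b)) ^ (a / (a + b)) * (E z ^ a) ^ (b / (a + b)) ∂ν := by
          rw [← setLIntegral_one]
          refine lintegral_congr_ae ?_
          filter_upwards [hfin] with z hz
          rw [← ENNReal.rpow_mul, ← ENNReal.rpow_mul, ← ENNReal.rpow_add _ _ hz.1 hz.2,
            show -b * (a / (a + b)) + a * (b / (a + b)) = 0 by ring, ENNReal.rpow_zero]
      _ ≤ _ := ENNReal.lintegral_mul_norm_pow_le (hE.pow_const _).aemeasurable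
          (hE.pow_const _).aemeasurable hs.le ht hst
  have h1 : 1 ≤ w ^ (a / (a + b)) * m ^ (b / (a + b)) := by
    refine hc.trans ?_
    rw [hw, hm, ENNReal.mul_rpow_of_nonneg _ _ hs.le, ENNReal.mul_rpow_of_nonneg _ _ ht,
      mul_mul_mul_comm, ← ENNReal.rpow_add_of_nonneg _ _ hs.le ht, hst, ENNReal.rpow_one]
    gcongr
  have h2 : 1 ≤ w * m ^ (b / a) := by
    have h := ENNReal.rpow_le_rpow h1 (inv_nonneg.2 hs.le)
    rwa [ENNReal.one_rpow, ENNReal.mul_rpow_of_nonneg _ _ (inv_nonneg.2 hs.le),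
      ← ENNReal.rpow_mul, ← ENNReal.rpow_mul, mul_inv_cancel₀ hs.ne', ENNReal.rpow_one,
      show b / (a + b) * (a / (a + b))⁻¹ = b / a by field_simp] at h
  rw [ENNReal.rpow_neg, ← one_div]
  exact ENNReal.div_le_of_le_mul h2

theorem le_energy (f : DyadicRectangle → ℝ) {R : DyadicRectangle} {z : ℝ × ℝ}
    (hz : z ∈ DyadicRectangle.toSet R) : ENNReal.ofReal (f R ^ 2) ≤ energy f z := by
  refine le_trans (le_of_eq ?_) (ENNReal.le_tsum R)
  rw [indicator_of_mem hz]

theorem exists_of_energy_ne_zero {f : DyadicRectangle → ℝ} {z : ℝ × ℝ} (hz : energy f z ≠ 0) :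
    ∃ R : DyadicRectangle, z ∈ DyadicRectangle.toSet R ∧ f R ≠ 0 := by
  by_contra! h
  refine hz (ENNReal.tsum_eq_zero.2 fun R => ?_)
  by_cases hR : z ∈ DyadicRectangle.toSet R
  · simp [h R hR]
  · simp [hR]

theorem lintegral_mul_energy {w : ℝ × ℝ → ℝ≥0∞} (hw : Measurable w) (f : DyadicRectangle → ℝ)
    (ν : Measure (ℝ × ℝ)) :
    ∫⁻ z, w z * energy f z ∂ν =
      ∑' R : DyadicRectangle,
        ENNReal.ofReal (f R ^ 2) * ∫⁻ z in DyadicRectangle.toSet R, w z ∂ν := by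
  simp_rw [energy, ← ENNReal.tsum_mul_left]
  rw [lintegral_tsum (f := fun R z => w z *
    (DyadicRectangle.toSet R).indicator (fun _ => ENNReal.ofReal (f R ^ 2)) z) fun R =>
    (hw.mul (measurable_const.indicator R.measurableSet_toSet)).aemeasurable]
  refine tsum_congr fun R => ?_
  rw [← lintegral_const_mul' _ _ ENNReal.ofReal_ne_top,
    ← lintegral_indicator R.measurableSet_toSet]
  refine lintegral_congr fun z => ?_
  by_cases hz : z ∈ DyadicRectangle.toSet R
  · simp [hz, mul_comm]
  · simp [hz]

/-- The coefficient of the extremal function in the lower estimate: `|f_R|` times the square root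
of the average over `R` of `S(f)^(-2b)`, normalised by `K`. -/
noncomputable def extremalArray (b : ℝ) (K : ℝ≥0∞) (f : DyadicRectangle → ℝ) :
    DyadicRectangle → ℝ := fun R =>
  |f R| * √(DyadicRectangle.invArea R * (∫⁻ z in DyadicRectangle.toSet R, energy f z ^ (-b)
    ∂(unitMeasure.prod unitMeasure)) / K).toReal

/-- On R the energy is at least f_R² > 0, so its negative power is bounded there. Hence `toReal` in
`extremalArray` loses nothing. -/
theorem extremalWeight_ne_top {b : ℝ} (hb : 0 ≤ b) {K : ℝ≥0∞} (hK : K ≠ 0)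
    {f : DyadicRectangle → ℝ} {R : DyadicRectangle} (hR : f R ≠ 0) :
    DyadicRectangle.invArea R * (∫⁻ z in DyadicRectangle.toSet R, energy f z ^ (-b)
      ∂(unitMeasure.prod unitMeasure)) / K ≠ ∞ := by
  have hpos : ENNReal.ofReal (f R ^ 2) ≠ 0 := by
    rw [Ne, ENNReal.ofReal_eq_zero, not_le]
    positivity
  refine ENNReal.div_ne_top (ENNReal.mul_ne_top R.invArea_ne_top ?_) hK
  refine ne_top_of_le_ne_top (b := ∫⁻ _ in DyadicRectangle.toSet R,
    ENNReal.ofReal (f R ^ 2) ^ (-b) ∂(unitMeasure.prod unitMeasure)) ?_ ?_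
  · rw [setLIntegral_const]
    refine ENNReal.mul_ne_top ?_ (measure_ne_top _ _)
    exact ENNReal.rpow_ne_top_of_ne_zero hpos ENNReal.ofReal_ne_top
  · refine setLIntegral_mono measurable_const fun z hz => ?_
    rw [ENNReal.rpow_neg, ENNReal.rpow_neg]
    exact ENNReal.inv_le_inv.2 (ENNReal.rpow_le_rpow (le_energy f hz) hb)

theorem ofReal_extremalArray_sq {b : ℝ} (hb : 0 ≤ b) {K : ℝ≥0∞} (hK : K ≠ 0)
    (f : DyadicRectangle → ℝ) (R : DyadicRectangle) :
    ENNReal.ofReal (extremalArray b K f R ^ 2) = ENNReal.ofReal (f R ^ 2) *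
      (DyadicRectangle.invArea R * (∫⁻ z in DyadicRectangle.toSet R, energy f z ^ (-b)
        ∂(unitMeasure.prod unitMeasure)) / K) := by
  by_cases hR : f R = 0
  · simp [extremalArray, hR]
  rw [extremalArray, mul_pow, sq_abs, Real.sq_sqrt ENNReal.toReal_nonneg,
    ENNReal.ofReal_mul (sq_nonneg _), ENNReal.ofReal_toReal (extremalWeight_ne_top hb hK hR)]

theorem lintegral_energy_extremalArray_le {b : ℝ} (hb : 0 ≤ b) (hb1 : b < 1)
    {f : DyadicRectangle → ℝ} {K : ℝ≥0∞} (hK0 : K ≠ 0)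
    (hK : ∫⁻ z, energy f z ^ (1 - b) ∂(unitMeasure.prod unitMeasure) ≤ K) :
    ∫⁻ z, energy (extremalArray b K f) z ∂(unitMeasure.prod unitMeasure) ≤ 1 := by
  set ν := unitMeasure.prod unitMeasure with hν
  have hE := measurable_energy f
  calc ∫⁻ z, energy (extremalArray b K f) z ∂ν
      = ∫⁻ z, 1 * energy (extremalArray b K f) z ∂ν := by simp
    _ = ∑' R, ENNReal.ofReal (extremalArray b K f R ^ 2) *
          ∫⁻ _ in DyadicRectangle.toSet R, 1 ∂ν :=
        lintegral_mul_energy measurable_const _ _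
    _ = ∑' R, ENNReal.ofReal (f R ^ 2) *
          (∫⁻ z in DyadicRectangle.toSet R, energy f z ^ (-b) ∂ν) / K := by
        refine tsum_congr fun R => ?_
        rw [ofReal_extremalArray_sq hb hK0, setLIntegral_one, ← hν]
        simp only [div_eq_mul_inv]
        calc _ = ENNReal.ofReal (f R ^ 2) *
              (∫⁻ z in DyadicRectangle.toSet R, energy f z ^ (-b) ∂ν) * K⁻¹ *
              (DyadicRectangle.invArea R * ν (DyadicRectangle.toSet R)) := by ring
          _ = _ := by rw [R.invArea_mul_measure, mul_one]
    _ = (∫⁻ z, energy f z ^ (-b) * energy f z ∂ν) / K := by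
        rw [lintegral_mul_energy (hE.pow_const _)]
        simp only [div_eq_mul_inv]
        rw [ENNReal.tsum_mul_right]
    -- Equality can fail where the energy is infinite, since ∞^(-b) * ∞ = 0 for b > 0.
    _ ≤ (∫⁻ z, energy f z ^ (1 - b) ∂ν) / K := by
        gcongr with z
        rcases eq_or_ne (energy f z) 0 with h0 | h0
        · simp [h0]
        rcases eq_or_ne (energy f z) ∞ with ht | ht
        · rw [ht, ENNReal.top_rpow_of_pos (sub_pos.2 hb1)]
          exact le_top
        nth_rewrite 2 [← ENNReal.rpow_one (energy f z)]
        rw [← ENNReal.rpow_add _ _ h0 ht, neg_add_eq_sub]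
    _ ≤ 1 := ENNReal.div_le_of_le_mul (by rwa [one_mul])

/-- Each R containing z contributes f_R² times the θ-th power of its weight. Jensen and the maximal
function bound that weight below by a quantity independent of R. -/
theorem energy_mul_le_energy_calderonProduct_extremalArray {a b θ : ℝ} (ha : 0 < a) (hb : 0 ≤ b)
    (h0 : 0 < θ) (h1 : θ < 1) {f : DyadicRectangle → ℝ} {K : ℝ≥0∞} (hK0 : K ≠ 0)
    (hfin : ∀ᵐ z ∂(unitMeasure.prod unitMeasure), energy f z ≠ ∞) (z : ℝ × ℝ) :
    energy f z * (strongMaximal (fun w => energy f w ^ a) z ^ (-(b / a)) / K) ^ θ ≤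
      energy (calderonProduct θ f (extremalArray b K f)) z := by
  rw [energy, ← ENNReal.tsum_mul_right, energy]
  refine ENNReal.tsum_le_tsum fun R => ?_
  by_cases hz : z ∈ DyadicRectangle.toSet R
  swap
  · simp [hz]
  simp only [indicator_of_mem hz]
  by_cases hR : f R = 0
  · simp [hR]
  have hpos : ENNReal.ofReal (f R ^ 2) ≠ 0 := by
    rw [Ne, ENNReal.ofReal_eq_zero, not_le]
    positivity
  rw [ofReal_calderonProduct_sq h0 h1, ofReal_extremalArray_sq hb hK0,
    ENNReal.mul_rpow_of_nonneg _ _ h0.le, ← mul_assoc,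
    ← ENNReal.rpow_add _ _ hpos ENNReal.ofReal_ne_top, sub_add_cancel, ENNReal.rpow_one]
  gcongr
  refine le_trans ?_ (rpow_average_le_average_rpow (measurable_energy f) ha hb ?_
    R.invArea_mul_measure.ge)
  · rw [ENNReal.rpow_neg, ENNReal.rpow_neg]
    refine ENNReal.inv_le_inv.2 (ENNReal.rpow_le_rpow ?_ (by positivity))
    exact R.average_le_strongMaximal ((measurable_energy f).pow_const a) hz
  · filter_upwards [ae_restrict_mem R.measurableSet_toSet, ae_restrict_of_ae hfin] with w hw hw'
    exact ⟨fun h => hpos (le_antisymm (h ▸ le_energy f hw) (zero_le)), hw'⟩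

theorem strongMaximal_energy_ne_zero {a : ℝ} (ha : 0 < a) {f : DyadicRectangle → ℝ} {z : ℝ × ℝ}
    (hz : energy f z ≠ 0) : strongMaximal (fun w => energy f w ^ a) z ≠ 0 := by
  obtain ⟨R, hR, hf⟩ := exists_of_energy_ne_zero hz
  have hpos : 0 < ENNReal.ofReal (f R ^ 2) ^ a :=
    ENNReal.rpow_pos (by rw [ENNReal.ofReal_pos]; positivity) ENNReal.ofReal_ne_top
  refine (hpos.trans_le (le_trans ?_
    (R.average_le_strongMaximal ((measurable_energy f).pow_const a) hR))).ne'
  calc ENNReal.ofReal (f R ^ 2) ^ a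
      = DyadicRectangle.invArea R * ∫⁻ _ in DyadicRectangle.toSet R,
          ENNReal.ofReal (f R ^ 2) ^ a ∂(unitMeasure.prod unitMeasure) := by
        rw [setLIntegral_const, mul_left_comm, R.invArea_mul_measure, mul_one]
    _ ≤ _ := by
        gcongr 1
        exact setLIntegral_mono ((measurable_energy f).pow_const a) fun w hw =>
          ENNReal.rpow_le_rpow (le_energy f hw) ha.le

theorem rpow_le_of_le_mul_rpow {K X : ℝ≥0∞} (h0 : K ≠ 0) (ht : K ≠ ∞) {r : ℝ}
    (h : K ≤ X * K ^ (1 - r)) : K ^ r ≤ X := by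
  calc K ^ r = K * K ^ (r - 1) := by
        nth_rewrite 2 [← ENNReal.rpow_one K]
        rw [← ENNReal.rpow_add _ _ h0 ht]
        congr 1; ring
    _ ≤ X * K ^ (1 - r) * K ^ (r - 1) := by gcongr
    _ = X := by
        rw [mul_assoc, ← ENNReal.rpow_add _ _ h0 ht]
        simp

/-- E^(p/2) is split by Hölder with weights p/q and 1 - p/q = θ(1 - p/2), so that the powers of M
cancel. The choice a = p/4 makes the L² maximal bound return ∫ (E^a)² = K. -/
theorem lintegral_energy_rpow_le {p θ q : ℝ} (hp : 0 < p) (hp2 : p ≤ 2) (h0 : 0 < θ) (h1 : θ < 1)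
    (hq : 1 / q = (1 - θ) / p + θ / 2) {f : DyadicRectangle → ℝ} {K : ℝ≥0∞}
    (hK : ∫⁻ z, energy f z ^ (p / 2) ∂(unitMeasure.prod unitMeasure) = K)
    (hK0 : K ≠ 0) (hKt : K ≠ ∞) :
    K ≤ (K ^ (θ * q / 2) * ∫⁻ z, energy (calderonProduct θ f (extremalArray (1 - p / 2) K f)) z
      ^ (q / 2) ∂(unitMeasure.prod unitMeasure)) ^ (p / q) * (16 * K) ^ (1 - p / q) := by
  have h1' : 0 < 1 - θ := sub_pos.2 h1
  have hq0 : 0 < q := one_div_pos.1 (by rw [hq]; positivity)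
  have hb : 0 ≤ 1 - p / 2 := by linarith
  have ha : 0 < p / 4 := by positivity
  have hpq : 1 - p / q = θ * (1 - p / 2) := by
    have : p / q = p * (1 / q) := by ring
    rw [this, hq]
    field_simp
    ring
  have hpq0 : 0 ≤ 1 - p / q := by rw [hpq]; positivity
  set ν := unitMeasure.prod unitMeasure with hν
  set b := 1 - p / 2 with hbdef
  set E := energy f with hEdef
  set M := strongMaximal (fun w => E w ^ (p / 4)) with hM
  have hE : Measurable E := measurable_energy f
  have hMm : Measurable M := measurable_strongMaximal (hE.pow_const _)
  have hM2 : ∫⁻ z, M z ^ 2 ∂ν ≤ 16 * K := by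
    refine (lintegral_strongMaximal_sq_le (hE.pow_const _)).trans (le_of_eq ?_)
    rw [← hK]
    congr 1
    refine lintegral_congr fun z => ?_
    rw [← ENNReal.rpow_natCast, ← ENNReal.rpow_mul]
    congr 1
    push_cast; ring
  have hMt : ∀ᵐ z ∂ν, M z ≠ ∞ := by
    have := ae_lt_top (hMm.pow_const 2) (ne_top_of_le_ne_top (ENNReal.mul_ne_top (by simp) hKt) hM2)
    filter_upwards [this] with z hz h
    simp [h] at hz
  have hEt : ∀ᵐ z ∂ν, E z ≠ ∞ := by
    have := ae_lt_top (hE.pow_const (p / 2)) (hK ▸ hKt)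
    filter_upwards [this] with z hz h
    rw [h, ENNReal.top_rpow_of_pos (by positivity)] at hz
    exact lt_irrefl _ hz
  have hexp : b / (p / 4) * θ * p / 2 = 2 * (1 - p / q) := by
    rw [hpq]; field_simp; ring
  have hlow : ∫⁻ z, E z ^ (q / 2) * M z ^ (-(b / (p / 4) * (θ * q / 2))) ∂ν ≤
      K ^ (θ * q / 2) * ∫⁻ z, energy (calderonProduct θ f (extremalArray b K f)) z
        ^ (q / 2) ∂ν := by
    rw [← lintegral_const_mul' _ _ (ENNReal.rpow_ne_top_of_nonneg (by positivity) hKt)]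
    refine lintegral_mono fun z => ?_
    have h := ENNReal.rpow_le_rpow (energy_mul_le_energy_calderonProduct_extremalArray ha hb h0 h1
      hK0 hEt z) (show 0 ≤ q / 2 by positivity)
    refine le_trans (le_of_eq ?_) (mul_le_mul_right h (K ^ (θ * q / 2)))
    rw [ENNReal.mul_rpow_of_nonneg _ _ (show 0 ≤ q / 2 by positivity), ← ENNReal.rpow_mul _ θ,
      show θ * (q / 2) = θ * q / 2 by ring,
      ENNReal.div_rpow_of_nonneg _ _ (show 0 ≤ θ * q / 2 by positivity), mul_left_comm,
      ENNReal.mul_div_cancel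
        (by simp [ENNReal.rpow_eq_zero_iff, hK0, hKt])
        (ENNReal.rpow_ne_top_of_nonneg (by positivity) hKt),
      ← ENNReal.rpow_mul, neg_mul]
  calc K = ∫⁻ z, E z ^ (p / 2) ∂ν := hK.symm
    _ ≤ ∫⁻ z, (E z ^ (q / 2) * M z ^ (-(b / (p / 4) * (θ * q / 2)))) ^ (p / q) *
          (M z ^ 2) ^ (1 - p / q) ∂ν := by
        refine lintegral_mono_ae ?_
        filter_upwards [hMt] with z hz
        rcases eq_or_ne (E z) 0 with hz0 | hz0
        · rw [hz0, ENNReal.zero_rpow_of_pos (by positivity)]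
          exact zero_le
        have hM0 : M z ≠ 0 := strongMaximal_energy_ne_zero ha hz0
        refine le_of_eq ?_
        rw [ENNReal.mul_rpow_of_nonneg _ _ (by positivity), ← ENNReal.rpow_natCast,
          ← ENNReal.rpow_mul, ← ENNReal.rpow_mul, ← ENNReal.rpow_mul, mul_assoc,
          ← ENNReal.rpow_add _ _ hM0 hz,
          show q / 2 * (p / q) = p / 2 by field_simp,
          show -(b / (p / 4) * (θ * q / 2)) * (p / q) + ((2 : ℕ) : ℝ) * (1 - p / q) = 0 by
            push_cast
            rw [← hexp]
            field_simp
            ring,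
          ENNReal.rpow_zero, mul_one]
    _ ≤ (∫⁻ z, E z ^ (q / 2) * M z ^ (-(b / (p / 4) * (θ * q / 2))) ∂ν) ^ (p / q) *
          (∫⁻ z, M z ^ 2 ∂ν) ^ (1 - p / q) :=
        ENNReal.lintegral_mul_norm_pow_le
          ((hE.pow_const _).mul (hMm.pow_const _)).aemeasurable (hMm.pow_const 2).aemeasurable
          (by positivity) hpq0 (add_sub_cancel _ _)
    _ ≤ _ := by gcongr

theorem le_extrapolationSup {p θ q : ℝ} (hp : 0 < p) (hp2 : p ≤ 2) (h0 : 0 < θ) (h1 : θ < 1)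
    (hq : 1 / q = (1 - θ) / p + θ / 2) {f : DyadicRectangle → ℝ} (hf : hardyNorm p f ≠ ∞) :
    ENNReal.ofReal (16 ^ (-(1 / p))) * hardyNorm p f ^ (1 - θ) ≤ extrapolationSup θ q f := by
  have h1' : 0 < 1 - θ := sub_pos.2 h1
  have hq0 : 0 < q := one_div_pos.1 (by rw [hq]; positivity)
  rw [hardyNorm_eq] at hf ⊢
  set ν := unitMeasure.prod unitMeasure with hν
  set K := ∫⁻ z, energy f z ^ (p / 2) ∂ν with hK
  have hKt : K ≠ ∞ := by
    intro h
    rw [h, ENNReal.top_rpow_of_pos (by positivity)] at hf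
    exact hf rfl
  rcases eq_or_ne K 0 with hK0 | hK0
  · rw [hK0, ENNReal.zero_rpow_of_pos (by positivity), ENNReal.zero_rpow_of_pos h1', mul_zero]
    exact zero_le
  set g := extremalArray (1 - p / 2) K f with hg
  have hg1 : hardyNorm 2 g ≤ 1 := by
    rw [hardyNorm_eq]
    refine ENNReal.rpow_le_one ?_ (by norm_num)
    have := lintegral_energy_extremalArray_le (b := 1 - p / 2) (by linarith)
      (by linarith) (f := f) hK0 (by rw [sub_sub_cancel])
    simpa using this
  refine le_trans ?_ (le_iSup₂ (f := fun (g : DyadicRectangle → ℝ) (_ : hardyNorm 2 g ≤ 1) =>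
    hardyNorm q (calderonProduct θ f g)) g hg1)
  have hmain := lintegral_energy_rpow_le hp hp2 h0 h1 hq hK.symm hK0 hKt
  rw [hardyNorm_eq]
  set A := ∫⁻ z, energy (calderonProduct θ f g) z ^ (q / 2) ∂ν with hA
  have hpq : 0 ≤ 1 - p / q := by
    have : p / q = p * (1 / q) := by ring
    rw [this, hq]
    have : 1 - p * ((1 - θ) / p + θ / 2) = θ * (1 - p / 2) := by field_simp; ring
    rw [this]
    have : 0 ≤ 1 - p / 2 := by linarith
    positivity
  rw [ENNReal.mul_rpow_of_nonneg _ _ hpq, ← mul_assoc] at hmain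
  have h2 := ENNReal.rpow_le_rpow (rpow_le_of_le_mul_rpow hK0 hKt hmain)
    (show 0 ≤ 1 / p by positivity)
  rw [ENNReal.mul_rpow_of_nonneg _ _ (show 0 ≤ 1 / p by positivity),
    ENNReal.mul_rpow_of_nonneg _ _ (show 0 ≤ p / q by positivity),
    ENNReal.mul_rpow_of_nonneg _ _ (show 0 ≤ 1 / p by positivity),
    ← ENNReal.rpow_mul, ← ENNReal.rpow_mul, ← ENNReal.rpow_mul, ← ENNReal.rpow_mul,
    ← ENNReal.rpow_mul,
    show p / q * (1 / p) = 1 / q by field_simp,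
    show θ * q / 2 * (1 / q) = θ / 2 by field_simp] at h2
  -- Enlarging the exponent makes the constant independent of θ and q.
  have h3 : (16 : ℝ≥0∞) ^ ((1 - p / q) * (1 / p)) ≤ 16 ^ (1 / p) := by
    refine ENNReal.rpow_le_rpow_of_exponent_le (by norm_num) ?_
    have : 0 ≤ p / q := by positivity
    calc (1 - p / q) * (1 / p) ≤ 1 * (1 / p) := by gcongr; linarith
      _ = 1 / p := one_mul _
  have h4 : K ^ (1 / q) ≤ A ^ (1 / q) * 16 ^ (1 / p) * K ^ (θ / 2) :=
    calc K ^ (1 / q) ≤ _ := h2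
      _ ≤ K ^ (θ / 2) * A ^ (1 / q) * 16 ^ (1 / p) := by gcongr
      _ = _ := by ring
  have h5 : K ^ (1 / q - θ / 2) ≤ A ^ (1 / q) * 16 ^ (1 / p) := by
    calc K ^ (1 / q - θ / 2) = K ^ (1 / q) * K ^ (-(θ / 2)) := by
          rw [← ENNReal.rpow_add _ _ hK0 hKt, sub_eq_add_neg]
      _ ≤ A ^ (1 / q) * 16 ^ (1 / p) * K ^ (θ / 2) * K ^ (-(θ / 2)) := by gcongr
      _ = _ := by
          rw [mul_assoc _ (K ^ (θ / 2)), ← ENNReal.rpow_add _ _ hK0 hKt]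
          simp
  have h6 : ENNReal.ofReal (16 ^ (-(1 / p))) = ((16 : ℝ≥0∞) ^ (1 / p))⁻¹ := by
    rw [← ENNReal.ofReal_rpow_of_pos (by norm_num), ENNReal.rpow_neg, ENNReal.ofReal_ofNat]
  rw [h6, ← ENNReal.rpow_mul, show 1 / p * (1 - θ) = 1 / q - θ / 2 by rw [hq]; ring, mul_comm,
    ← div_eq_mul_inv]
  exact ENNReal.div_le_of_le_mul h5

end LowerBound

/-! ### Finite truncations and arrays of infinite norm. -/

section Truncation

/-- The restriction of an array to the first `n` dyadic rectangles of an enumeration. -/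
noncomputable def truncation (f : DyadicRectangle → ℝ) (n : ℕ) : DyadicRectangle → ℝ :=
  fun R => if Encodable.encode R < n then f R else 0

theorem energy_mono {f g : DyadicRectangle → ℝ} (h : ∀ R, |f R| ≤ |g R|) (z : ℝ × ℝ) :
    energy f z ≤ energy g z := by
  refine ENNReal.tsum_le_tsum fun R => indicator_le_indicator ?_
  exact ENNReal.ofReal_le_ofReal (sq_le_sq.2 (h R))

theorem hardyNorm_mono {p : ℝ} (hp : 0 < p) {f g : DyadicRectangle → ℝ}
    (h : ∀ R, |f R| ≤ |g R|) : hardyNorm p f ≤ hardyNorm p g := by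
  rw [hardyNorm_eq, hardyNorm_eq]
  refine ENNReal.rpow_le_rpow (lintegral_mono fun z => ?_) (by positivity)
  exact ENNReal.rpow_le_rpow (energy_mono h z) (by positivity)

theorem extrapolationSup_mono {θ q : ℝ} (h1 : θ < 1) (hq : 0 < q) {f g : DyadicRectangle → ℝ}
    (h : ∀ R, |f R| ≤ |g R|) : extrapolationSup θ q f ≤ extrapolationSup θ q g := by
  refine iSup₂_mono fun u _ => hardyNorm_mono hq fun R => ?_
  have hθ : 0 ≤ 1 - θ := sub_nonneg.2 h1.le
  rw [calderonProduct, calderonProduct, abs_mul, abs_mul, Real.abs_rpow_of_nonneg (abs_nonneg _),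
    Real.abs_rpow_of_nonneg (abs_nonneg (g R)), abs_abs, abs_abs]
  exact mul_le_mul_of_nonneg_right (Real.rpow_le_rpow (abs_nonneg _) (h R) hθ) (abs_nonneg _)

theorem abs_truncation_le (f : DyadicRectangle → ℝ) {m n : ℕ} (hmn : m ≤ n) (R : DyadicRectangle) :
    |truncation f m R| ≤ |truncation f n R| := by
  unfold truncation
  split_ifs with h h'
  · exact le_rfl
  · exact absurd (h.trans_le hmn) h'
  · simp
  · exact le_rfl

theorem abs_truncation_le_abs (f : DyadicRectangle → ℝ) (n : ℕ) (R : DyadicRectangle) :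
    |truncation f n R| ≤ |f R| := by
  unfold truncation
  split_ifs <;> simp

theorem iSup_energy_truncation (f : DyadicRectangle → ℝ) (z : ℝ × ℝ) :
    ⨆ n, energy (truncation f n) z = energy f z := by
  refine le_antisymm (iSup_le fun n => energy_mono (abs_truncation_le_abs f n) z) ?_
  rw [energy, ENNReal.tsum_eq_iSup_sum]
  refine iSup_le fun s => ?_
  refine le_trans ?_ (le_iSup _ (s.sup Encodable.encode + 1))
  refine le_trans (le_of_eq ?_) (ENNReal.sum_le_tsum s)
  refine Finset.sum_congr rfl fun R hR => ?_
  have : Encodable.encode R < s.sup Encodable.encode + 1 :=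
    Nat.lt_succ_of_le (Finset.le_sup (f := Encodable.encode) hR)
  simp only [truncation, this, if_true]

theorem finite_support_truncation (f : DyadicRectangle → ℝ) (n : ℕ) :
    {R | truncation f n R ≠ 0}.Finite := by
  refine ((finite_Iio n).preimage Encodable.encode_injective.injOn).subset fun R hR => ?_
  by_contra h
  exact hR (if_neg h)

theorem hardyNorm_ne_top_of_finite {p : ℝ} (hp : 0 < p) {f : DyadicRectangle → ℝ}
    (hf : {R | f R ≠ 0}.Finite) : hardyNorm p f ≠ ∞ := by
  rw [hardyNorm_eq]
  refine ENNReal.rpow_ne_top_of_nonneg (by positivity) ?_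
  refine ne_top_of_le_ne_top (b := ∫⁻ _, (∑ R ∈ hf.toFinset, ENNReal.ofReal (f R ^ 2)) ^ (p / 2)
    ∂(unitMeasure.prod unitMeasure)) ?_ (lintegral_mono fun z => ?_)
  · rw [lintegral_const]
    refine ENNReal.mul_ne_top (ENNReal.rpow_ne_top_of_nonneg (by positivity) ?_)
      (measure_ne_top _ _)
    exact ENNReal.sum_ne_top.2 fun R _ => ENNReal.ofReal_ne_top
  · refine ENNReal.rpow_le_rpow ?_ (by positivity)
    rw [energy, tsum_eq_sum (s := hf.toFinset)]
    · exact Finset.sum_le_sum fun R _ => indicator_le_self _ _ _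
    · intro R hR
      have : f R = 0 := by simpa using hR
      simp [this]

theorem iSup_hardyNorm_truncation {p : ℝ} (hp : 0 < p) (f : DyadicRectangle → ℝ) :
    ⨆ n, hardyNorm p (truncation f n) = hardyNorm p f := by
  simp_rw [hardyNorm_eq]
  have hsup : ∀ {r : ℝ}, 0 < r → ∀ u : ℕ → ℝ≥0∞, (⨆ n, u n) ^ r = ⨆ n, u n ^ r :=
    fun {r} hr u => (ENNReal.orderIsoRpow r hr).map_iSup u
  rw [← hsup (by positivity)]
  congr 1
  rw [← lintegral_iSup (fun n => (measurable_energy _).pow_const _)]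
  · refine lintegral_congr fun z => ?_
    rw [← hsup (by positivity), iSup_energy_truncation]
  · intro m n hmn z
    exact ENNReal.rpow_le_rpow (energy_mono (abs_truncation_le f hmn) z) (by positivity)

/-- No finiteness of the norm is assumed: truncations have finite norm, the supremum is monotone in
the array, and their norms increase to that of `f`. -/
theorem hardyNorm_le_of_forall_truncation {p θ q : ℝ} (hp : 0 < p) (hp2 : p ≤ 2) (h0 : 0 < θ)
    (h1 : θ < 1) (hq : 1 / q = (1 - θ) / p + θ / 2) (f : DyadicRectangle → ℝ) :
    ENNReal.ofReal (16 ^ (-(1 / p))) ^ (1 / (1 - θ)) * hardyNorm p f ≤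
      extrapolationSup θ q f ^ (1 / (1 - θ)) := by
  have h1' : 0 < 1 - θ := sub_pos.2 h1
  have hq0 : 0 < q := one_div_pos.1 (by rw [hq]; positivity)
  rw [← iSup_hardyNorm_truncation hp, ENNReal.mul_iSup]
  refine iSup_le fun n => ?_
  have h := ENNReal.rpow_le_rpow ((le_extrapolationSup hp hp2 h0 h1 hq
    (hardyNorm_ne_top_of_finite hp (finite_support_truncation f n))).trans
    (extrapolationSup_mono h1 hq0 (abs_truncation_le_abs f n))) (one_div_pos.2 h1').le
  rwa [ENNReal.mul_rpow_of_nonneg _ _ (one_div_pos.2 h1').le, ← ENNReal.rpow_mul,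
    mul_one_div_cancel h1'.ne', ENNReal.rpow_one] at h

end Truncation

/-! ### The two assertions assembled. -/

theorem theorem4p1 :
    (∀ p : ℝ, 0 < p → p ≤ 2 → ∃ c : ℝ, 0 < c ∧
      ∀ θ q : ℝ, 0 < θ → θ < 1 → 1 / q = (1 - θ) / p + θ / 2 →
        ∀ f ∈ hardySpace p,
          ENNReal.ofReal c * hardyNorm p f ^ (1 - θ) ≤ extrapolationSup θ q f ∧
          extrapolationSup θ q f ≤ hardyNorm p f ^ (1 - θ)) ∧
    (∀ p : ℝ, 1 < p → p < 2 →
      pisierLattice p = hardySpace 1 ∧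
      ∃ c : ℝ, 0 < c ∧ ∀ x : DyadicRectangle → ℝ,
        ENNReal.ofReal c * hardyNorm 1 x ≤ pisierNorm p x ∧
        pisierNorm p x ≤ hardyNorm 1 x) := by
  refine ⟨fun p hp hp2 => ⟨16 ^ (-(1 / p)), by positivity, fun θ q h0 h1 hq f hf =>
    ⟨le_extrapolationSup hp hp2 h0 h1 hq (ne_of_lt hf), extrapolationSup_le hp h0 h1 hq f⟩⟩,
    fun p hp1 hp2 => ?_⟩
  have hp0 : 0 < p := by linarith
  have h0 : 0 < 2 - 2 / p := by
    rw [sub_pos, div_lt_iff₀ hp0]; linarith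
  have h1 : 2 - 2 / p < 1 := by
    have : 1 < 2 / p := by rw [lt_div_iff₀ hp0]; linarith
    linarith
  have h1' : 0 < 1 - (2 - 2 / p) := sub_pos.2 h1
  -- The exponent relation with endpoint 1 and target p, which is what fixes θ = 2 - 2/p.
  have hq : 1 / p = (1 - (2 - 2 / p)) / 1 + (2 - 2 / p) / 2 := by ring
  have hupper : ∀ x, pisierNorm p x ≤ hardyNorm 1 x := by
    intro x
    have h := ENNReal.rpow_le_rpow (extrapolationSup_le one_pos h0 h1 hq x) (one_div_pos.2 h1').le
    rwa [← ENNReal.rpow_mul, mul_one_div_cancel h1'.ne', ENNReal.rpow_one] at h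
  have hc : 0 < ((16 : ℝ) ^ (-(1 / (1 : ℝ)))) ^ (1 / (1 - (2 - 2 / p))) := by positivity
  have hlower : ∀ x, ENNReal.ofReal (((16 : ℝ) ^ (-(1 / (1 : ℝ)))) ^ (1 / (1 - (2 - 2 / p)))) *
      hardyNorm 1 x ≤ pisierNorm p x := by
    intro x
    rw [← ENNReal.ofReal_rpow_of_pos (by positivity)]
    exact hardyNorm_le_of_forall_truncation one_pos one_le_two h0 h1 hq x
  refine ⟨Set.ext fun x => ⟨fun hx => ?_, fun hx => (hupper x).trans_lt hx⟩,
    _, hc, fun x => ⟨hlower x, hupper x⟩⟩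
  have h := (hlower x).trans_lt hx
  by_contra htop
  have htop' : hardyNorm 1 x = ∞ := not_lt_top_iff.1 htop
  rw [htop', ENNReal.mul_top (by simpa using hc)] at h
  exact lt_irrefl _ h
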